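/- Let $\mathbb{D}$ be the open unit disk. A (finite) Blaschke product of degree $d$ is a function $B(z)=\gamma\prod_{j=1}^{d}\frac{z-a_j}{1-\overline{a_j}z}$ on $\mathbb{D}$ with $|\gamma|=1$ and $a_1,\dots,a_d\in\mathbb{D}$. Its critical points are the points $z\in\mathbb{D}$ with $B'(z)=0$, and its critical values are the numbers $B(z)\in\mathbb D$ with $z$ a critical point. Call $B$ regularized if $B(0)=0$, all zeros of $B$ in $\mathbb{D}$ are simple, and whenever $z_1,z_2$ are critical points such that $B(z_1)/B(z_2)$ is a positive real number, then $B(z_1)=B(z_2)$. For a regularized $B$ let $V\subset\mathbb{D}\setminus\{0\}$ be the set of critical values and let $Z=B^{-1}(0)\subset\mathbb{D}$. A loop $\gamma$ in $\mathbb{D}\setminus V$ based at $0$ induces the permutation $\sigma_\gamma$ of $Z$ that sends $z\in Z$ to the endpoint of the lift of $\gamma$ through $B$ that starts at $z$ (equivalently, identifying a branch $g$ of $B^{-1}$ at $0$ with the zero $g(0)$, it permutes the branches by continuation along $\gamma$). The monodromy group $G_B$ of $B$ is the group of all permutations $\sigma_\gamma$. Theorem. Let $B$ be a regularized Blaschke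 product whose critical points, counted with multiplicity, are distinct, and which has exactly $n$ distinct critical values. Suppose that $B=B_n\circ\cdots\circ B_1$ on $\mathbb{D}$, where each $B_j$ is a regularized Blaschke product of degree $2$ with $B_j(0)=0$. Then the monodromy group $G_B$ is the $n$-fold iterated wreath product $\mathbb{Z}_2\wr\cdots\wr\mathbb{Z}_2$ of cyclic groups of order $2$: there are a bijection of $Z$ with the $2^n$ leaves $\mathbb{Z}_2^n$ of the rooted binary tree of height $n$ and an isomorphism of $G_B$ onto the iterated wreath product that carry the action of $G_B$ on $Z$ to the standard (imprimitive) action of the iterated wreath product on the leaves. -/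

import Mathlib

open Set Metric

namespace FiniteBlaschke

/-- `B` is, on the open unit disk, a finite Blaschke product of degree `d`:
`B z = γ * ∏ j, (z - a j) / (1 - conj (a j) * z)` with `|γ| = 1` and all `|a j| < 1`.
Only the values on the open unit disk matter, here and in all definitions below. -/
def IsBlaschke (d : ℕ) (B : ℂ → ℂ) : Prop :=
  ∃ (γ : ℂ) (a : Fin d → ℂ), ‖γ‖ = 1 ∧ (∀ j, ‖a j‖ < 1) ∧
    ∀ z ∈ ball (0 : ℂ) 1,
      B z = γ * ∏ j, (z - a j) / (1 - (starRingEnd ℂ) (a j) * z)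

/-- The critical points of `B` in the open unit disk. -/
def criticalPoints (B : ℂ → ℂ) : Set ℂ := {z ∈ ball (0 : ℂ) 1 | deriv B z = 0}

/-- The critical values of `B`. -/
def criticalValues (B : ℂ → ℂ) : Set ℂ := B '' criticalPoints B

/-- The zeros of `B` in the open unit disk, that is, the fibre of `B` over `0`. -/
def zeros (B : ℂ → ℂ) : Set ℂ := {z ∈ ball (0 : ℂ) 1 | B z = 0}

/-- The critical points of `B`, counted with multiplicity, are distinct: every zero of `B'` in the
open unit disk is simple. -/
def HasDistinctCriticalPoints (B : ℂ → ℂ) : Prop :=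
  ∀ z ∈ criticalPoints B, deriv (deriv B) z ≠ 0

/-- `B` is regularized: it fixes `0`, its zeros are simple, and two critical values whose
quotient is a positive real number are equal. -/
structure IsRegularized (B : ℂ → ℂ) : Prop where
  map_zero : B 0 = 0
  simple_zeros : ∀ z ∈ zeros B, deriv B z ≠ 0
  eq_of_pos : ∀ z₁ ∈ criticalPoints B, ∀ z₂ ∈ criticalPoints B,
    (∃ t : ℝ, 0 < t ∧ B z₁ / B z₂ = (t : ℂ)) → B z₁ = B z₂

theorem IsRegularized.zero_notMem {B : ℂ → ℂ} (h : IsRegularized B) :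
    (0 : ℂ) ∉ criticalValues B := by
  rintro ⟨z, ⟨hz, hd⟩, h0⟩
  exact h.simple_zeros z ⟨hz, h0⟩ hd

/-- `composite C n = C n ∘ ⋯ ∘ C 1` (the identity for `n = 0`). -/
def composite (C : ℕ → ℂ → ℂ) : ℕ → ℂ → ℂ
  | 0 => id
  | k + 1 => C (k + 1) ∘ composite C k

/-- The loop `γ` based at `0` induces the permutation `σ` of the fibre of `B` over `0`: for each
point `z` of the fibre, `γ` has a lift through `B` to a path in the open unit disk from `z`
to `σ z`. When `0` is not a critical value, a local inverse (branch) `g` of `B` at `0` is the same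
datum as the point `g 0` of the fibre, and for a loop `γ` that avoids the critical values, the
continuation of `g` along `γ` is the branch with value `σ (g 0)` at `0`. -/
def Induces (B : ℂ → ℂ) (γ : Path (0 : ℂ) 0) (σ : Equiv.Perm (zeros B)) : Prop :=
  ∀ z : zeros B, ∃ Γ : Path (z : ℂ) (σ z : ℂ), ∀ t, Γ t ∈ ball (0 : ℂ) 1 ∧ B (Γ t) = γ t

/-- The monodromy group of `B`, for `0` not a critical value: all permutations of the fibre over
`0` that are induced by loops based at `0` in the open unit disk minus the critical values. -/
def monodromyGroup (B : ℂ → ℂ) (h0 : (0 : ℂ) ∉ criticalValues B) :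
    Subgroup (Equiv.Perm (zeros B)) where
  carrier := {σ | ∃ γ : Path (0 : ℂ) 0,
    (∀ t, γ t ∈ ball (0 : ℂ) 1 \ criticalValues B) ∧ Induces B γ σ}
  one_mem' := by
    refine ⟨Path.refl 0, fun t => ⟨by simp, by simpa using h0⟩, fun z => ⟨Path.refl _, fun t => ?_⟩⟩
    exact ⟨z.2.1, z.2.2⟩
  mul_mem' := by
    rintro σ τ ⟨γ, hγ, hσ⟩ ⟨δ, hδ, hτ⟩
    refine ⟨δ.trans γ, fun t => ?_, fun z => ?_⟩
    · rw [Path.trans_apply]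
      split_ifs
      exacts [hδ _, hγ _]
    · obtain ⟨Δ, hΔ⟩ := hτ z
      obtain ⟨Γ, hΓ⟩ := hσ (τ z)
      have key : ∀ t, (Δ.trans Γ) t ∈ ball (0 : ℂ) 1 ∧ B ((Δ.trans Γ) t) = (δ.trans γ) t := by
        intro t
        rw [Path.trans_apply, Path.trans_apply]
        split_ifs
        exacts [hΔ _, hΓ _]
      exact ⟨Δ.trans Γ, key⟩
  inv_mem' := by
    rintro σ ⟨γ, hγ, hσ⟩
    refine ⟨γ.symm, fun t => hγ _, fun z => ?_⟩
    obtain ⟨Γ, hΓ⟩ := hσ (σ⁻¹ z)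
    exact ⟨Γ.symm.cast (by simp) rfl, fun t => hΓ _⟩

end FiniteBlaschke

/-! Up to disk automorphisms before and after, each factor of degree two is a squaring
(`FiniteBlaschke.IsBlaschke.exists_eqOn_fold`). Choosing a square root at every stage labels the
fibres of the composite by the leaves of a binary tree. Continuation along a path respects the tree,
so it acts on labels through the iterated wreath product (`FoldTower.exists_transport`). With
uniqueness of lifts (`FoldTower.lift_unique`) this gives one inclusion.

For the other, the iterated wreath product is a finite 2-group, so a proper subgroup lies in a
subgroup of index two, the kernel of a sign character. Every character factors through the products
of the labels over the `n` levels, so it suffices that monodromy realizes all `n`-tuples of level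
products (`eq_top_of_map_levelProd_eq_top`).

These products are visible analytically. Multiplying a disk automorphism with zero `a` over a fibre
of one factor gives a constant times the automorphism whose zero is the image of `a`
(`FoldTower.exists_prod_mob_eq`). Pushed through the tower, this shows that the `j`-th level product
is the sign that a square root of `mob (T.values n j)` acquires along the loop. Regularity puts the
`n` distinct critical values on different rays from `0`, so some loop changes the sign for exactly
one of them (`exists_loop`), and these loops generate all tuples. -/

/-! ### Abelianization of the iterated wreath product -/

/-- The homomorphism from the iterated wreath product of a commutative group to `Fin n → G` whose
`j`-th component multiplies the labels of all the nodes at the `j`-th level of the tree. -/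
def levelProd (G : Type*) [CommGroup G] [Fintype G] :
    (n : ℕ) → (IteratedWreathProduct G n →* (Fin n → G))
  | 0 => 1
  | n + 1 =>
    { toFun := fun w => Fin.snoc (∏ x, levelProd G n (RegularWreathProduct.left w x))
        (RegularWreathProduct.right w)
      map_one' := by
        funext i
        refine Fin.lastCases ?_ (fun j => ?_) i
        · rw [Fin.snoc_last]; rfl
        · rw [Fin.snoc_castSucc]
          have : ∀ x : G, (RegularWreathProduct.left (1 : IteratedWreathProduct G n ≀ᵣ G) x) = 1 :=
            fun _ => rfl
          change (∏ x, levelProd G n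
            (RegularWreathProduct.left (1 : IteratedWreathProduct G n ≀ᵣ G) x)) j = 1
          simp
      map_mul' := by
        intro a b
        change IteratedWreathProduct G n ≀ᵣ G at a b
        change Fin.snoc (α := fun _ => G) (∏ x, levelProd G n ((a * b).left x)) (a * b).right = _
        funext i
        refine Fin.lastCases ?_ (fun j => ?_) i
        · simp
        -- The root label of `a` only permutes the subtrees of `b`, which a product in a commutative
        -- group does not notice.
        · have h : ∏ x, levelProd G n (b.left (a.right⁻¹ * x)) = ∏ x, levelProd G n (b.left x) :=
            Fintype.prod_equiv (Equiv.mulLeft a.right⁻¹) _ _ (fun _ => rfl)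
          simp only [RegularWreathProduct.mul_left, Pi.mul_apply, map_mul, Finset.prod_mul_distrib,
            Fin.snoc_castSucc, h] }

section

variable {G : Type*} [CommGroup G] [Fintype G]

theorem levelProd_succ_last (n : ℕ) (w : IteratedWreathProduct G n ≀ᵣ G) :
    levelProd G (n + 1) w (Fin.last n) = w.right :=
  Fin.snoc_last (α := fun _ => G) _ _

theorem levelProd_succ_castSucc (n : ℕ) (w : IteratedWreathProduct G n ≀ᵣ G) (j : Fin n) :
    levelProd G (n + 1) w j.castSucc = ∏ x, levelProd G n (w.left x) j := by
  refine (Fin.snoc_castSucc (α := fun _ => G) _ _ _).trans ?_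
  simp

/-- Conjugation by `inl x` moves the factor of the base group at `1` to the one at `x`, and a
homomorphism to a commutative group is constant on conjugacy classes. Hence only the embedding at
`1` and the top group matter. -/
theorem RegularWreathProduct.eq_prod_mulSingle_mul_inl {D : Type*} [Group D] [DecidableEq G]
    {A : Type*} [CommGroup A] (χ : D ≀ᵣ G →* A) (w : D ≀ᵣ G) :
    χ w = (∏ x, χ ⟨Pi.mulSingle 1 (w.left x), 1⟩) * χ (RegularWreathProduct.inl w.right) := by
  let ι : (G → D) →* D ≀ᵣ G :=
    { toFun := fun f => ⟨f, 1⟩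
      map_one' := rfl
      map_mul' := fun f g => by ext <;> simp }
  have hw : w = ι w.left * RegularWreathProduct.inl w.right := by
    ext <;> simp [ι]
  have key : ∀ (x : G) (d : D), χ (ι (Pi.mulSingle x d)) = χ (ι (Pi.mulSingle 1 d)) := by
    intro x d
    have : ι (Pi.mulSingle x d) = RegularWreathProduct.inl x * ι (Pi.mulSingle 1 d) *
        (RegularWreathProduct.inl x)⁻¹ := by
      ext y
      · simp only [ι, Pi.mulSingle_apply, MonoidHom.coe_mk, OneHom.coe_mk,
          RegularWreathProduct.mul_left, RegularWreathProduct.left_inl, Pi.mul_apply, Pi.one_apply,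
          one_mul, RegularWreathProduct.right_inl, RegularWreathProduct.inv_left, Pi.inv_apply,
          inv_one, mul_one]
        simp only [inv_mul_eq_one, eq_comm]
      · simp [ι]
    rw [this, map_mul, map_mul, map_inv, mul_inv_cancel_comm]
  have hprod : ∀ (f : G → D), χ (ι f) = ∏ x, χ (ι (Pi.mulSingle x (f x))) := by
    intro f
    exact (congrArg (χ.comp ι) (Finset.noncommProd_mulSingle f).symm).trans
      ((Finset.map_noncommProd _ _ _ (χ.comp ι)).trans (Finset.noncommProd_eq_prod _ _))
  conv_lhs => rw [hw, map_mul, hprod]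
  congr 1
  exact Finset.prod_congr rfl fun x _ => key x _

/-- Every homomorphism from the iterated wreath product to a commutative group factors through
`levelProd`, which therefore is the abelianization. -/
theorem exists_eq_comp_levelProd {A : Type*} [CommGroup A] (n : ℕ)
    (χ : IteratedWreathProduct G n →* A) :
    ∃ ψ : (Fin n → G) →* A, χ = ψ.comp (levelProd G n) := by
  classical
  induction n with
  | zero => exact ⟨1, MonoidHom.ext fun w => by
      rw [show w = 1 from Subsingleton.elim (α := PUnit) _ _, map_one, map_one]⟩
  | succ n ih =>
    let ι : IteratedWreathProduct G n →* IteratedWreathProduct G n ≀ᵣ G :=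
      { toFun := fun d => ⟨Pi.mulSingle 1 d, 1⟩
        map_one' := by ext <;> simp
        map_mul' := fun f g => by ext <;> simp [Pi.mulSingle_mul] }
    obtain ⟨ψ, hψ⟩ := ih (MonoidHom.comp χ ι)
    let init : (Fin (n + 1) → G) →* (Fin n → G) :=
      { toFun := fun u => Fin.init u
        map_one' := rfl
        map_mul' := fun _ _ => rfl }
    refine ⟨ψ.comp init * (MonoidHom.comp χ RegularWreathProduct.inl).comp
      (Pi.evalMonoidHom (fun _ => G) (Fin.last n)), MonoidHom.ext fun w => ?_⟩
    change IteratedWreathProduct G n ≀ᵣ G at w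
    have h := RegularWreathProduct.eq_prod_mulSingle_mul_inl χ w
    have h2 : ∀ x, χ ⟨Pi.mulSingle 1 (w.left x), 1⟩ = ψ (levelProd G n (w.left x)) :=
      fun x => DFunLike.congr_fun hψ (w.left x)
    have h3 : init (levelProd G (n + 1) w) = ∏ x, levelProd G n (w.left x) := by
      funext j
      rw [Finset.prod_apply]
      exact levelProd_succ_castSucc n w j
    refine h.trans ((congrArg (· * _) (Finset.prod_congr rfl fun x _ => h2 x)).trans ?_)
    rw [← map_prod, ← h3, ← levelProd_succ_last n w]
    rfl

/-- A subgroup of the iterated wreath product of a group of order two that surjects onto the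
abelianization is everything. -/
theorem eq_top_of_map_levelProd_eq_top (hG : Nat.card G = 2) (n : ℕ)
    (H : Subgroup (IteratedWreathProduct G n)) (hH : H.map (levelProd G n) = ⊤) : H = ⊤ := by
  classical
  have : Fact (Nat.Prime 2) := ⟨Nat.prime_two⟩
  by_contra hne
  have hc := IteratedWreathProduct.card G n
  rw [hG] at hc
  generalize (∑ i ∈ Finset.range n, 2 ^ i) = N at hc
  obtain ⟨m, hm, hHm⟩ := (Nat.dvd_prime_pow Nat.prime_two).1 (hc ▸ H.card_subgroup_dvd_card)
  have hmN : m < N := by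
    refine lt_of_le_of_ne hm fun h => hne ?_
    exact Subgroup.eq_top_of_card_eq _ (by rw [hHm, hc, h])
  -- In a finite 2-group a proper subgroup can be enlarged to one of index two.
  obtain ⟨K, hK, hHK⟩ := Sylow.exists_subgroup_card_pow_prime_le 2 (n := m) (m := N - 1)
    (by rw [hc]; exact pow_dvd_pow _ (by omega)) H hHm (by omega)
  have hidx : K.index = 2 := by
    have h := K.card_mul_index
    rw [hK, hc, show N = N - 1 + 1 by omega, pow_succ, Nat.add_sub_cancel] at h
    exact Nat.eq_of_mul_eq_mul_left (by positivity) h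
  let χ : IteratedWreathProduct G n →* ℤˣ :=
    { toFun := fun g => if g ∈ K then 1 else -1
      map_one' := by simp
      map_mul' := fun a b => by
        simp only [Subgroup.mul_mem_iff_of_index_two hidx]
        by_cases ha : a ∈ K <;> by_cases hb : b ∈ K <;> simp [ha, hb] }
  obtain ⟨ψ, hψ⟩ := exists_eq_comp_levelProd n χ
  -- Each `g` has the same level products as some `h ∈ H ≤ K`, so `χ g = χ h = 1`; this contradicts
  -- index two.
  have hKtop : K = ⊤ := by
    rw [eq_top_iff]
    intro g _
    obtain ⟨h, hh, hg⟩ : levelProd G n g ∈ H.map (levelProd G n) := hH ▸ Subgroup.mem_top _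
    have h1 : χ g = χ h := by rw [hψ, MonoidHom.comp_apply, MonoidHom.comp_apply, hg]
    have h2 : χ h = 1 := if_pos (hHK hh)
    by_contra hgK
    have h3 : χ g = -1 := if_neg hgK
    rw [h1, h2] at h3
    exact absurd h3 (by decide)
  rw [hKtop, Subgroup.index_top] at hidx
  omega

end

/-- The last coordinate of a leaf is its label at the root. It moves first, and its new value
selects the element that acts on the subtree; `FoldTower.leaf` is built to match. -/
theorem iteratedWreathToPermHom_succ {G : Type*} [Group G] (n : ℕ)
    (w : IteratedWreathProduct G n ≀ᵣ G) (u : Fin (n + 1) → G) :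
    iteratedWreathToPermHom G (n + 1) w u =
      Fin.snoc (α := fun _ => G) (iteratedWreathToPermHom G n
        (w.left (w.right * u (Fin.last n))) (Fin.init u)) (w.right * u (Fin.last n)) := by
  let _ := MulAction.compHom (Fin n → G) (iteratedWreathToPermHom G n)
  change (Fin.succFunEquiv G n).symm (w • Fin.succFunEquiv G n u) = _
  rw [RegularWreathProduct.smul_def, Equiv.symm_apply_eq]
  have h : ∀ v : Fin (n + 1) → G, Fin.succFunEquiv G n v = (Fin.init v, v (Fin.last n)) :=
    fun v => rfl
  rw [h, h, Fin.init_snoc, Fin.snoc_last]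
  rfl

/-! ### Disk automorphisms -/

section

open scoped ComplexConjugate unitInterval Topology
open Filter

/-- The disk automorphism sending `a` to `0`. -/
noncomputable def mob (a z : ℂ) : ℂ := (z - a) / (1 - conj a * z)

section mob

variable {a b z : ℂ}

theorem one_sub_conj_mul_mem_slitPlane (ha : ‖a‖ < 1) (hz : ‖z‖ < 1) :
    1 - conj a * z ∈ Complex.slitPlane := by
  rw [sub_eq_add_neg]
  refine Complex.mem_slitPlane_of_norm_lt_one ?_
  rw [norm_neg, norm_mul, RCLike.norm_conj]
  exact mul_lt_one_of_nonneg_of_lt_one_left (norm_nonneg _) ha hz.le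

theorem one_sub_conj_mul_ne_zero (ha : ‖a‖ < 1) (hz : ‖z‖ < 1) : 1 - conj a * z ≠ 0 :=
  Complex.slitPlane_ne_zero (one_sub_conj_mul_mem_slitPlane ha hz)

theorem one_sub_normSq_ne_zero (ha : ‖a‖ < 1) : 1 - conj a * a ≠ 0 :=
  one_sub_conj_mul_ne_zero ha ha

theorem norm_mob_lt_one (ha : ‖a‖ < 1) (hz : ‖z‖ < 1) : ‖mob a z‖ < 1 := by
  have h0 := norm_pos_iff.2 (one_sub_conj_mul_ne_zero ha hz)
  rw [mob, norm_div, div_lt_one h0, ← abs_of_nonneg (norm_nonneg (z - a)),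
    ← abs_of_pos h0, ← sq_lt_sq, ← Complex.normSq_eq_norm_sq, ← Complex.normSq_eq_norm_sq]
  have h1 : Complex.normSq a < 1 := by
    rw [Complex.normSq_eq_norm_sq]; nlinarith [norm_nonneg a]
  have h2 : Complex.normSq z < 1 := by
    rw [Complex.normSq_eq_norm_sq]; nlinarith [norm_nonneg z]
  simp only [Complex.normSq_apply, Complex.sub_re, Complex.sub_im, Complex.mul_re, Complex.mul_im,
    Complex.conj_re, Complex.conj_im, Complex.one_re, Complex.one_im] at *
  nlinarith

theorem mob_neg_mob (ha : ‖a‖ < 1) (hz : ‖z‖ < 1) : mob (-a) (mob a z) = z := by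
  have h0 := one_sub_conj_mul_ne_zero ha hz
  have h1 := one_sub_normSq_ne_zero ha
  have h2 := one_sub_conj_mul_ne_zero (a := -a) (by simpa) (norm_mob_lt_one ha hz)
  rw [mob, div_eq_iff h2, mob, map_neg]
  generalize conj a = a' at *
  rw [sub_neg_eq_add, div_add' _ _ _ h0, neg_mul, sub_neg_eq_add, mul_div_assoc', one_add_div h0,
    mul_div_assoc']
  congr 1
  ring

theorem mob_mob_neg (ha : ‖a‖ < 1) (hz : ‖z‖ < 1) : mob a (mob (-a) z) = z := by
  simpa using mob_neg_mob (a := -a) (by simpa) hz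

theorem mob_self : mob a a = 0 := by simp [mob]

theorem mob_eq_zero_iff (ha : ‖a‖ < 1) (hz : ‖z‖ < 1) : mob a z = 0 ↔ z = a := by
  rw [mob, div_eq_zero_iff, or_iff_left (one_sub_conj_mul_ne_zero ha hz), sub_eq_zero]

theorem mob_zero : mob a 0 = -a := by simp [mob]

theorem hasDerivAt_mob (ha : ‖a‖ < 1) (hz : ‖z‖ < 1) :
    HasDerivAt (mob a) ((1 - conj a * a) / (1 - conj a * z) ^ 2) z := by
  have h := ((hasDerivAt_id z).sub_const a).div
    (((hasDerivAt_id z).const_mul (conj a)).const_sub 1) (one_sub_conj_mul_ne_zero ha hz)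
  convert! h using 1
  simp only [id]
  ring

theorem Continuous.mob {X : Type*} [TopologicalSpace X] {f : X → ℂ} (hf : Continuous f)
    (ha : ‖a‖ < 1) (h : ∀ x, ‖f x‖ < 1) : Continuous fun x => mob a (f x) :=
  continuous_iff_continuousAt.2 fun x =>
    ContinuousAt.comp (f := f) (hasDerivAt_mob ha (h x)).continuousAt hf.continuousAt

/-- Composing two disk automorphisms gives a third one, up to a constant factor. -/
theorem exists_mob_mob_neg (ha : ‖a‖ < 1) (hb : ‖b‖ < 1) :
    ∃ κ ≠ 0, ∀ z, ‖z‖ < 1 → mob a (mob (-b) z) = κ * mob (mob b a) z := by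
  have h1 := one_sub_conj_mul_ne_zero ha hb
  have h2 := one_sub_conj_mul_ne_zero hb ha
  refine ⟨(1 - conj b * a) / (1 - conj a * b), div_ne_zero h2 h1, fun z hz => ?_⟩
  have hb' : ‖-b‖ < 1 := by simpa
  have h3 := one_sub_conj_mul_ne_zero hb' hz
  have h4 := one_sub_conj_mul_ne_zero ha (norm_mob_lt_one hb' hz)
  have h5 := one_sub_conj_mul_ne_zero (norm_mob_lt_one hb ha) hz
  rw [mob, show mob (mob b a) z = (z - mob b a) / (1 - conj (mob b a) * z) from rfl,
    div_mul_div_comm, div_eq_div_iff h4 (mul_ne_zero h1 h5)]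
  have h6 : conj (mob b a) = (conj a - conj b) / (1 - conj a * b) := by
    simp [mob, mul_comm]
  have h7 : mob b a = (a - b) / (1 - conj b * a) := rfl
  have h8 : mob (-b) z = (z + b) / (1 + conj b * z) := by simp [mob]
  have h3' : 1 + conj b * z ≠ 0 := by simpa using h3
  rw [h6, h7, h8]
  generalize conj a = a' at *
  generalize conj b = b' at *
  clear h3 h4 h5 h6 h7 h8
  have e1 : (z + b) / (1 + b' * z) - a = (z + b - a * (1 + b' * z)) / (1 + b' * z) := by
    rw [div_sub' h3', mul_comm a]
  have e2 : 1 - a' * ((z + b) / (1 + b' * z)) = (1 + b' * z - a' * (z + b)) / (1 + b' * z) := by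
    rw [← mul_div_assoc, one_sub_div h3']
  have e3 : z - (a - b) / (1 - b' * a) = (z * (1 - b' * a) - (a - b)) / (1 - b' * a) :=
    sub_div' h2
  have e4 : 1 - (a' - b') / (1 - a' * b) * z =
      ((1 - a' * b) - (a' - b') * z) / (1 - a' * b) := by
    rw [div_mul_eq_mul_div, one_sub_div h1]
  rw [e1, e2, e3, e4, mul_div_cancel₀ _ h2, mul_div_cancel₀ _ h1, div_mul_eq_mul_div,
    mul_div_assoc']
  congr 1
  ring

/-- This is the product over a fibre of the plain squaring map; the general fold reduces to it by
changes of coordinate. -/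
theorem mob_mul_mob_neg (hb : ‖b‖ < 1) (hz : ‖z‖ < 1) :
    mob b z * mob b (-z) = -mob (b ^ 2) (z ^ 2) := by
  have h1 := one_sub_conj_mul_ne_zero hb hz
  have h2 := one_sub_conj_mul_ne_zero (z := -z) hb (by simpa)
  have h3 : 1 - conj (b ^ 2) * z ^ 2 = (1 - conj b * z) * (1 - conj b * -z) := by
    rw [map_pow]; ring
  rw [mob, mob, mob, h3, div_mul_div_comm, ← neg_div]
  congr 1
  ring

theorem mob_mul_left {g : ℂ} (hg : ‖g‖ = 1) : mob (g * a) (g * z) = g * mob a z := by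
  have h : conj g * g = 1 := by rw [mul_comm, Complex.mul_conj, Complex.normSq_eq_norm_sq, hg]; simp
  rw [mob, mob, ← mul_sub, map_mul,
    show conj g * conj a * (g * z) = conj g * g * (conj a * z) by ring, h, one_mul, mul_div_assoc]

end mob

/-! ### Folds: squarings between disk automorphisms -/

/-- The Blaschke product of degree two with critical point `c` and critical value `v`. -/
noncomputable def fold (c v g z : ℂ) : ℂ := mob (-v) (g * mob c z ^ 2)

section fold

variable {c v g z : ℂ}

theorem norm_mul_sq_lt_one (hg : ‖g‖ = 1) (hz : ‖z‖ < 1) : ‖g * z ^ 2‖ < 1 := by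
  rw [norm_mul, hg, one_mul, norm_pow]
  exact pow_lt_one₀ (norm_nonneg _) hz two_ne_zero

theorem norm_fold_lt_one (hc : ‖c‖ < 1) (hv : ‖v‖ < 1) (hg : ‖g‖ = 1) (hz : ‖z‖ < 1) :
    ‖fold c v g z‖ < 1 :=
  norm_mob_lt_one (by simpa) (norm_mul_sq_lt_one hg (norm_mob_lt_one hc hz))

theorem mob_fold (hc : ‖c‖ < 1) (hv : ‖v‖ < 1) (hg : ‖g‖ = 1) (hz : ‖z‖ < 1) :
    mob v (fold c v g z) = g * mob c z ^ 2 :=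
  mob_mob_neg hv (norm_mul_sq_lt_one hg (norm_mob_lt_one hc hz))

theorem fold_eq_iff (hc : ‖c‖ < 1) (hv : ‖v‖ < 1) (hg : ‖g‖ = 1) (hz : ‖z‖ < 1) {y : ℂ}
    (hy : ‖y‖ < 1) : fold c v g z = y ↔ g * mob c z ^ 2 = mob v y := by
  constructor
  · rintro rfl
    exact (mob_fold hc hv hg hz).symm
  · intro h
    rw [fold, h, mob_neg_mob hv hy]

theorem fold_self : fold c v g c = v := by simp [fold, mob_self, mob_zero]

/-- The factor `k` is left implicit, since all that matters is that the derivative vanishes exactly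
at `c`. -/
theorem hasDerivAt_fold (hc : ‖c‖ < 1) (hv : ‖v‖ < 1) (hg : ‖g‖ = 1) (hz : ‖z‖ < 1) :
    ∃ k ≠ 0, HasDerivAt (fold c v g) (k * mob c z) z := by
  have hg0 : g ≠ 0 := norm_ne_zero_iff.1 (by rw [hg]; exact one_ne_zero)
  have hv' : ‖-v‖ < 1 := by simpa
  have hw := norm_mul_sq_lt_one hg (norm_mob_lt_one hc hz)
  have h := HasDerivAt.comp z (hasDerivAt_mob hv' hw) (((hasDerivAt_mob hc hz).pow 2).const_mul g)
  refine ⟨(1 - conj (-v) * -v) / (1 - conj (-v) * (g * mob c z ^ 2)) ^ 2 *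
      (g * (2 * ((1 - conj c * c) / (1 - conj c * z) ^ 2))), ?_, h.congr_deriv ?_⟩
  · have h1 := one_sub_normSq_ne_zero hv'
    have h2 := one_sub_normSq_ne_zero hc
    have h3 := one_sub_conj_mul_ne_zero hv' hw
    have h4 := one_sub_conj_mul_ne_zero hc hz
    exact mul_ne_zero (div_ne_zero h1 (pow_ne_zero _ h3))
      (mul_ne_zero hg0 (mul_ne_zero two_ne_zero (div_ne_zero h2 (pow_ne_zero _ h4))))
  · simp only [Pi.pow_apply]
    push_cast
    ring

/-- The product of a disk automorphism over the fibre of a `fold`, as a function on the base. -/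
theorem exists_mob_mul_mob_fibre (hc : ‖c‖ < 1) (hv : ‖v‖ < 1) (hg : ‖g‖ = 1) {a : ℂ}
    (ha : ‖a‖ < 1) :
    ∃ κ ≠ 0, ∀ s y, ‖s‖ < 1 → ‖y‖ < 1 → g * s ^ 2 = mob v y →
      mob a (mob (-c) s) * mob a (mob (-c) (-s)) = κ * mob (fold c v g a) y := by
  have hg0 : g ≠ 0 := norm_ne_zero_iff.1 (by rw [hg]; exact one_ne_zero)
  obtain ⟨κ, hκ, h1⟩ := exists_mob_mob_neg ha hc
  have hb := norm_mob_lt_one hc ha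
  have hb2 := norm_mul_sq_lt_one hg hb
  obtain ⟨μ, hμ, h2⟩ := exists_mob_mob_neg (b := -v) hb2 (by simpa)
  -- `κ` recentres each of the two factors at `c`, the sign comes from `mob_mul_mob_neg`, `g⁻¹`
  -- undoes the rotation, and `μ` recentres the target at `v`.
  refine ⟨-(κ ^ 2 * g⁻¹ * μ), neg_ne_zero.2 (by positivity), fun s y hs hy h => ?_⟩
  have h3 := h2 y hy
  rw [neg_neg, ← h, mob_mul_left hg] at h3
  rw [h1 s hs, h1 (-s) (by simpa),
    show ∀ x y : ℂ, κ * x * (κ * y) = κ ^ 2 * (x * y) by intros; ring,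
    mob_mul_mob_neg hb hs, fold]
  rw [show mob (mob c a ^ 2) (s ^ 2) = g⁻¹ * (μ * mob (mob (-v) (g * mob c a ^ 2)) y) by
    rw [← h3, inv_mul_cancel_left₀ hg0]]
  ring

end fold

/-! ### Signs and square roots along paths -/

/-- The cyclic group of order two. -/
abbrev C2 : Type := Multiplicative (ZMod 2)

/-- The nontrivial character of the group of order two. -/
noncomputable def sgn : C2 →* ℂ where
  toFun x := if x = 1 then 1 else -1
  map_one' := by simp
  map_mul' a b := by
    have h : ∀ a b : C2, a * b = 1 ↔ (a = 1 ↔ b = 1) := by decide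
    simp only [h]
    by_cases ha : a = 1 <;> by_cases hb : b = 1 <;> simp [ha, hb]

theorem sgn_ofAdd_one : sgn (Multiplicative.ofAdd 1) = -1 :=
  @if_neg _ _ (show ¬ (Multiplicative.ofAdd 1 : C2) = 1 by decide) ℂ 1 (-1)

theorem sgn_sq (x : C2) : sgn x ^ 2 = 1 := by
  rw [← map_pow, show x ^ 2 = 1 by revert x; decide, map_one]

theorem sgn_injective : Function.Injective sgn := by
  intro a b h
  have h' : ∀ a : C2, a = 1 ∨ a = Multiplicative.ofAdd 1 := by decide
  have hne : (-1 : ℂ) ≠ 1 := by norm_num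
  rcases h' a with rfl | rfl <;> rcases h' b with rfl | rfl <;>
    simp_all [sgn_ofAdd_one, hne.symm]

theorem norm_sgn (x : C2) : ‖sgn x‖ = 1 := by
  have h := congrArg norm (sgn_sq x)
  rw [norm_pow, norm_one] at h
  exact (pow_eq_one_iff_of_nonneg (norm_nonneg _) two_ne_zero).1 h

theorem exists_eq_sgn_mul {a b : ℂ} (h : a ^ 2 = b ^ 2) : ∃ x : C2, a = sgn x * b := by
  rcases sq_eq_sq_iff_eq_or_eq_neg.1 h with h | h
  · exact ⟨1, by simp [h]⟩
  · exact ⟨Multiplicative.ofAdd 1, by simp [h, sgn_ofAdd_one]⟩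

theorem prod_C2 (F : C2 → ℂ) : ∏ x, F x = F 1 * F (Multiplicative.ofAdd 1) := by
  rw [show (Finset.univ : Finset C2) = {1, Multiplicative.ofAdd 1} by decide,
    Finset.prod_pair (by decide)]

/-- A nowhere vanishing function on the unit interval has a continuous square root. -/
theorem exists_continuous_sqrt {f : I → ℂ} (hf : Continuous f) (h0 : ∀ t, f t ≠ 0) {s₀ : ℂ}
    (hs : s₀ ^ 2 = f 0) : ∃ s : I → ℂ, Continuous s ∧ s 0 = s₀ ∧ ∀ t, s t ^ 2 = f t := by
  have hp : projIcc (0 : ℝ) 1 zero_le_one 0 = 0 := projIcc_left _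
  -- Squaring is a covering away from `0`; `f` is extended constantly to the real line and lifted
  -- there.
  obtain ⟨F, ⟨h1, h2⟩, -⟩ :=
    (isCoveringMapOn_npow (𝕜 := ℂ) 2 (by norm_num)).existsUnique_continuousMap_lifts
      (⟨fun x : ℝ => f (projIcc 0 1 zero_le_one x), hf.comp continuous_projIcc⟩ : C(ℝ, ℂ))
      (a₀ := 0) (e₀ := s₀) (by simpa [hp] using hs) (fun _ => h0 _)
  refine ⟨fun t => F t, by fun_prop, h1, fun t => (congrFun h2 t).trans ?_⟩
  change f (projIcc 0 1 zero_le_one (t : ℝ)) = f t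
  rw [projIcc_val]

theorem eq_of_sq_eq_of_zero_eq {f g : I → ℂ} (hf : Continuous f) (hg : Continuous g)
    (h : ∀ t, f t ^ 2 = g t ^ 2) (hg0 : ∀ t, g t ≠ 0) (h0 : f 0 = g 0) : f = g :=
  funext fun t => isPreconnected_univ.eq_of_sq_eq (S := univ) hf.continuousOn hg.continuousOn
    (fun t _ => h t) (fun _ => hg0 _) (mem_univ 0) h0 (mem_univ t)

/-! ### Towers of folds, labelled fibres and path lifting -/

/-- A sequence of Blaschke products of degree two, given by their critical points `c j`, their
critical values `v j` and their unimodular factors `g j`. -/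
structure FoldTower where
  /-- The critical points. -/
  c : ℕ → ℂ
  /-- The critical values. -/
  v : ℕ → ℂ
  /-- The unimodular factors. -/
  g : ℕ → ℂ
  norm_c : ∀ j, ‖c j‖ < 1
  norm_v : ∀ j, ‖v j‖ < 1
  norm_g : ∀ j, ‖g j‖ = 1

namespace FoldTower

variable (T : FoldTower)

theorem g_ne_zero (j : ℕ) : T.g j ≠ 0 :=
  norm_ne_zero_iff.1 (by rw [T.norm_g]; exact one_ne_zero)

theorem norm_neg_c (j : ℕ) : ‖-T.c j‖ < 1 := by simpa using T.norm_c j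

/-- The `j`-th Blaschke product of degree two. -/
noncomputable def map (j : ℕ) : ℂ → ℂ := fold (T.c j) (T.v j) (T.g j)

/-- The composition of the first `n` maps. -/
noncomputable def comp (n : ℕ) : ℂ → ℂ := FiniteBlaschke.composite T.map n

theorem comp_succ (n : ℕ) (z : ℂ) : T.comp (n + 1) z = T.map (n + 1) (T.comp n z) := rfl

theorem norm_map_lt_one (j : ℕ) {z : ℂ} (hz : ‖z‖ < 1) : ‖T.map j z‖ < 1 :=
  norm_fold_lt_one (T.norm_c j) (T.norm_v j) (T.norm_g j) hz

theorem norm_comp_lt_one (n : ℕ) {z : ℂ} (hz : ‖z‖ < 1) : ‖T.comp n z‖ < 1 := by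
  induction n with
  | zero => exact hz
  | succ n ih => exact T.norm_map_lt_one _ ih

/-- The critical values of `T.comp n`; the `j`-th one comes from the `j + 1`-st map. -/
noncomputable def values : (n : ℕ) → Fin n → ℂ
  | 0 => Fin.elim0
  | n + 1 => Fin.snoc (α := fun _ => ℂ) (fun j => T.map (n + 1) (values n j)) (T.v (n + 1))

theorem values_last (n : ℕ) : T.values (n + 1) (Fin.last n) = T.v (n + 1) :=
  Fin.snoc_last (α := fun _ => ℂ) _ _

theorem values_castSucc (n : ℕ) (j : Fin n) :
    T.values (n + 1) j.castSucc = T.map (n + 1) (T.values n j) :=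
  Fin.snoc_castSucc (α := fun _ => ℂ) _ _ _

theorem norm_values_lt_one (n : ℕ) (j : Fin n) : ‖T.values n j‖ < 1 := by
  induction n with
  | zero => exact j.elim0
  | succ n ih =>
    refine Fin.lastCases ?_ (fun j => ?_) j
    · rw [values_last]; exact T.norm_v _
    · rw [values_castSucc]; exact T.norm_map_lt_one _ (ih j)

/-- A square root of `mob (v j) y / g j`. -/
noncomputable def root (j : ℕ) (y : ℂ) : ℂ := ((T.g j)⁻¹ * mob (T.v j) y) ^ (((2 : ℕ) : ℂ)⁻¹)

theorem root_sq (j : ℕ) (y : ℂ) : T.root j y ^ 2 = (T.g j)⁻¹ * mob (T.v j) y :=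
  Complex.cpow_nat_inv_pow _ two_ne_zero

theorem norm_lt_one_of_sq_eq {j : ℕ} {s y : ℂ} (hy : ‖y‖ < 1)
    (h : s ^ 2 = (T.g j)⁻¹ * mob (T.v j) y) : ‖s‖ < 1 := by
  have h1 := congrArg norm h
  rw [norm_pow, norm_mul, norm_inv, T.norm_g, inv_one, one_mul] at h1
  have h2 := norm_mob_lt_one (T.norm_v j) hy
  rw [← h1] at h2
  exact (pow_lt_one_iff_of_nonneg (norm_nonneg _) two_ne_zero).1 h2

theorem norm_root_lt_one (j : ℕ) {y : ℂ} (hy : ‖y‖ < 1) : ‖T.root j y‖ < 1 :=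
  T.norm_lt_one_of_sq_eq hy (T.root_sq j y)

theorem root_ne_zero {j : ℕ} {y : ℂ} (hy : ‖y‖ < 1) (h : y ≠ T.v j) : T.root j y ≠ 0 := by
  intro h0
  have h1 := T.root_sq j y
  rw [h0, zero_pow two_ne_zero, eq_comm, mul_eq_zero, inv_eq_zero,
    or_iff_right (T.g_ne_zero j), mob_eq_zero_iff (T.norm_v j) hy] at h1
  exact h h1

theorem norm_mob_neg_sgn_mul_lt_one (j : ℕ) (x : C2) {s : ℂ} (hs : ‖s‖ < 1) :
    ‖mob (-T.c j) (sgn x * s)‖ < 1 :=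
  norm_mob_lt_one (T.norm_neg_c j) (by rwa [norm_mul, norm_sgn, one_mul])

theorem map_mob_neg_sgn_mul {j : ℕ} {s y : ℂ} (hy : ‖y‖ < 1)
    (h : s ^ 2 = (T.g j)⁻¹ * mob (T.v j) y) (x : C2) :
    T.map j (mob (-T.c j) (sgn x * s)) = y := by
  have hs := T.norm_lt_one_of_sq_eq hy h
  rw [map, fold_eq_iff (T.norm_c j) (T.norm_v j) (T.norm_g j)
    (T.norm_mob_neg_sgn_mul_lt_one j x hs) hy,
    mob_mob_neg (T.norm_c j) (by rwa [norm_mul, norm_sgn, one_mul]), mul_pow, sgn_sq, one_mul, h,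
    mul_inv_cancel_left₀ (T.g_ne_zero j)]

/-- The point of the fibre of the `j`-th map over `y` with label `x`. -/
noncomputable def branch (j : ℕ) (y : ℂ) (x : C2) : ℂ := mob (-T.c j) (sgn x * T.root j y)

theorem norm_branch_lt_one (j : ℕ) {y : ℂ} (hy : ‖y‖ < 1) (x : C2) : ‖T.branch j y x‖ < 1 :=
  T.norm_mob_neg_sgn_mul_lt_one j x (T.norm_root_lt_one j hy)

theorem map_branch (j : ℕ) {y : ℂ} (hy : ‖y‖ < 1) (x : C2) : T.map j (T.branch j y x) = y :=
  T.map_mob_neg_sgn_mul hy (T.root_sq j y) x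

theorem sq_mob_eq_of_map_eq {j : ℕ} {z y : ℂ} (hz : ‖z‖ < 1) (h : T.map j z = y) :
    mob (T.c j) z ^ 2 = (T.g j)⁻¹ * mob (T.v j) y := by
  rw [← h, map, mob_fold (T.norm_c j) (T.norm_v j) (T.norm_g j) hz,
    inv_mul_cancel_left₀ (T.g_ne_zero j)]

theorem exists_eq_branch {j : ℕ} {y z : ℂ} (hz : ‖z‖ < 1) (h : T.map j z = y) :
    ∃ x, z = T.branch j y x := by
  obtain ⟨x, hx⟩ := exists_eq_sgn_mul ((T.sq_mob_eq_of_map_eq hz h).trans (T.root_sq j y).symm)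
  exact ⟨x, by rw [branch, ← hx, mob_neg_mob (T.norm_c j) hz]⟩

theorem branch_injective {j : ℕ} {y : ℂ} (hy : ‖y‖ < 1) (h : y ≠ T.v j) :
    Function.Injective (T.branch j y) := by
  intro a b hab
  have hr := T.norm_root_lt_one j hy
  have h1 := congrArg (mob (T.c j)) hab
  rw [branch, branch, mob_mob_neg (T.norm_c j) (by rwa [norm_mul, norm_sgn, one_mul]),
    mob_mob_neg (T.norm_c j) (by rwa [norm_mul, norm_sgn, one_mul])] at h1
  exact sgn_injective (mul_right_cancel₀ (T.root_ne_zero hy h) h1)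

/-- This lets inductions descend the tower: a lift of a path that avoids the critical values avoids
those of the shorter composite. -/
theorem branch_ne_values {n : ℕ} {y z : ℂ} (h : T.map (n + 1) z = y)
    (hy : ∀ j, y ≠ T.values (n + 1) j) (j : Fin n) : z ≠ T.values n j := by
  rintro rfl
  exact hy j.castSucc (by rw [values_castSucc, h])

/-- The labelling of the fibre of `T.comp n` over `y` by the leaves of the binary tree. -/
noncomputable def leaf : (n : ℕ) → ℂ → (Fin n → C2) → ℂ
  | 0, y, _ => y
  | n + 1, y, u => leaf n (T.branch (n + 1) y (u (Fin.last n))) (Fin.init u)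

theorem leaf_succ (n : ℕ) (y : ℂ) (u : Fin (n + 1) → C2) :
    T.leaf (n + 1) y u = T.leaf n (T.branch (n + 1) y (u (Fin.last n))) (Fin.init u) := rfl

theorem norm_leaf_lt_one (n : ℕ) {y : ℂ} (hy : ‖y‖ < 1) (u : Fin n → C2) :
    ‖T.leaf n y u‖ < 1 := by
  induction n generalizing y with
  | zero => exact hy
  | succ n ih => exact ih (T.norm_branch_lt_one _ hy _) _

theorem comp_leaf (n : ℕ) {y : ℂ} (hy : ‖y‖ < 1) (u : Fin n → C2) :
    T.comp n (T.leaf n y u) = y := by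
  induction n generalizing y with
  | zero => rfl
  | succ n ih =>
    rw [comp_succ, leaf_succ, ih (T.norm_branch_lt_one _ hy _), T.map_branch _ hy]

theorem exists_eq_leaf {n : ℕ} {y z : ℂ} (hz : ‖z‖ < 1) (h : T.comp n z = y) :
    ∃ u, z = T.leaf n y u := by
  induction n generalizing y with
  | zero => exact ⟨Fin.elim0, h⟩
  | succ n ih =>
    obtain ⟨x, hx⟩ := T.exists_eq_branch (T.norm_comp_lt_one n hz) h
    obtain ⟨u, hu⟩ := ih hx
    exact ⟨Fin.snoc (α := fun _ => C2) u x, by rw [leaf_succ, Fin.init_snoc, Fin.snoc_last, hu]⟩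

theorem leaf_injective {n : ℕ} {y : ℂ} (hy : ‖y‖ < 1) (h : ∀ j, y ≠ T.values n j) :
    Function.Injective (T.leaf n y) := by
  induction n generalizing y with
  | zero => exact Function.injective_of_subsingleton _
  | succ n ih =>
    intro a b hab
    rw [leaf_succ, leaf_succ] at hab
    have hb := fun x => T.norm_branch_lt_one (n + 1) hy x
    have h1 : a (Fin.last n) = b (Fin.last n) := by
      refine T.branch_injective (j := n + 1) hy (by rw [← values_last]; exact h _) ?_
      rw [← T.comp_leaf n (hb (a (Fin.last n))) (Fin.init a), hab, T.comp_leaf n (hb _)]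
    rw [h1] at hab
    have h2 := ih (hb _) (T.branch_ne_values (T.map_branch _ hy _) h) hab
    rw [← Fin.snoc_init_self a, ← Fin.snoc_init_self b, h1, h2]

theorem continuous_mob_neg_sgn_mul (j : ℕ) (x : C2) {s : I → ℂ} (hs : Continuous s)
    (h : ∀ t, ‖s t‖ < 1) : Continuous fun t => mob (-T.c j) (sgn x * s t) :=
  Continuous.mob (f := fun t => sgn x * s t) (by fun_prop) (T.norm_neg_c j)
    fun t => by rw [norm_mul, norm_sgn, one_mul]; exact h t

/-- This is the step that carries a critical value up one stage. It allows any square root `s`,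
since along a path the continuous root need not be `root`. -/
theorem exists_prod_mob_eq {j : ℕ} {a : ℂ} (ha : ‖a‖ < 1) :
    ∃ κ ≠ 0, ∀ s y, ‖y‖ < 1 → s ^ 2 = (T.g j)⁻¹ * mob (T.v j) y →
      ∏ x, mob a (mob (-T.c j) (sgn x * s)) = κ * mob (T.map j a) y := by
  obtain ⟨κ, hκ, h⟩ := exists_mob_mul_mob_fibre (T.norm_c j) (T.norm_v j) (T.norm_g j) ha
  refine ⟨κ, hκ, fun s y hy hs => ?_⟩
  rw [prod_C2, map_one, one_mul, sgn_ofAdd_one, neg_one_mul]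
  refine h s y (T.norm_lt_one_of_sq_eq hy hs) hy ?_
  rw [hs, mul_inv_cancel_left₀ (T.g_ne_zero j)]

/-- Path lifting through `T.comp n`. The lifts of a path `p` induce a bijection of the fibres over
its endpoints, which in terms of the labels is an element `w` of the iterated wreath product. The
levels of `w` describe the continuation of square roots of the disk automorphisms that vanish at
the critical values. -/
theorem exists_transport (n : ℕ) :
    ∃ ρ : Fin n → ℂ → ℂ,
      (∀ y, ‖y‖ < 1 → (∀ j, y ≠ T.values n j) → ∀ j, ρ j y ≠ 0) ∧
      ∀ p : I → ℂ, Continuous p → (∀ t, ‖p t‖ < 1) → (∀ t j, p t ≠ T.values n j) →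
        ∃ w : IteratedWreathProduct C2 n,
          (∀ u, ∃ Γ : I → ℂ, Continuous Γ ∧ Γ 0 = T.leaf n (p 0) u ∧
            Γ 1 = T.leaf n (p 1) (iteratedWreathToPermHom C2 n w u) ∧
            ∀ t, ‖Γ t‖ < 1 ∧ T.comp n (Γ t) = p t) ∧
          ∀ j, ∃ r : I → ℂ, Continuous r ∧
            (∃ κ ≠ 0, ∀ t, r t ^ 2 = κ * mob (T.values n j) (p t)) ∧
            r 1 * ρ j (p 0) = sgn (levelProd C2 n w j) * r 0 * ρ j (p 1) := by
  induction n with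
  | zero =>
    refine ⟨fun _ _ => 1, fun _ _ _ _ => one_ne_zero, fun p hp h1 _ => ⟨PUnit.unit, ?_, ?_⟩⟩
    · exact fun u => ⟨p, hp, rfl, rfl, fun t => ⟨h1 t, rfl⟩⟩
    · exact fun j => j.elim0
  | succ n ih =>
    obtain ⟨ρ, hρ, ih⟩ := ih
    -- The reference values `ρ` compensate for the possibly discontinuous choice `root` at the two
    -- ends of a path. At the new level this is `root` itself; at the others, the product of the old
    -- references over the fibre.
    refine ⟨Fin.snoc (α := fun _ => ℂ → ℂ) (fun j y => ∏ x, ρ j (T.branch (n + 1) y x))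
      (T.root (n + 1)), fun y hy h j => ?_, fun p hp h1 h2 => ?_⟩
    · refine Fin.lastCases ?_ (fun j => ?_) j
      · rw [Fin.snoc_last]
        exact T.root_ne_zero hy (by rw [← values_last]; exact h _)
      · rw [Fin.snoc_castSucc]
        exact Finset.prod_ne_zero_iff.2 fun x _ => hρ _ (T.norm_branch_lt_one _ hy _)
          (T.branch_ne_values (T.map_branch _ hy _) h) j
    have hv : ∀ t, p t ≠ T.v (n + 1) := fun t => by rw [← values_last]; exact h2 t _
    obtain ⟨s, hs, hs0, hsq⟩ := exists_continuous_sqrt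
      (f := fun t => (T.g (n + 1))⁻¹ * mob (T.v (n + 1)) (p t))
      (continuous_const.mul (hp.mob (T.norm_v _) h1))
      (fun t => mul_ne_zero (inv_ne_zero (T.g_ne_zero _))
        ((mob_eq_zero_iff (T.norm_v _) (h1 t)).not.2 (hv t)))
      (T.root_sq (n + 1) (p 0))
    have hs1 := fun t => T.norm_lt_one_of_sq_eq (h1 t) (hsq t)
    -- The continued root ends at the chosen root up to the sign `q`, which becomes the label of `W`
    -- at the root of the tree.
    obtain ⟨q, hq⟩ := exists_eq_sgn_mul ((hsq 1).trans (T.root_sq (n + 1) (p 1)).symm)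
    have hm := fun t x => T.map_mob_neg_sgn_mul (h1 t) (hsq t) x
    choose w hw1 hw2 using fun x : C2 => ih (fun t => mob (-T.c (n + 1)) (sgn x * s t))
      (T.continuous_mob_neg_sgn_mul (n + 1) x hs hs1)
      (fun t => T.norm_mob_neg_sgn_mul_lt_one (n + 1) x (hs1 t))
      (fun t => T.branch_ne_values (hm t x) (h2 t))
    have hb0 : ∀ x, mob (-T.c (n + 1)) (sgn x * s 0) = T.branch (n + 1) (p 0) x :=
      fun x => by rw [hs0, branch]
    have hb1 : ∀ x, mob (-T.c (n + 1)) (sgn x * s 1) = T.branch (n + 1) (p 1) (q * x) :=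
      fun x => by rw [hq, branch, map_mul, ← mul_assoc, mul_comm (sgn x)]
    simp only [hb0, hb1] at hw1 hw2
    -- The lift that starts on branch `x` ends on branch `q * x`, and the action reads the subtree
    -- element at this new label; hence the shift by `q⁻¹`.
    let W : IteratedWreathProduct C2 n ≀ᵣ C2 := ⟨fun x => w (q⁻¹ * x), q⟩
    refine ⟨W, fun u => ?_, fun j => ?_⟩
    · obtain ⟨Γ, hΓ, hΓ0, hΓ1, hΓ2⟩ := hw1 (u (Fin.last n)) (Fin.init u)
      refine ⟨Γ, hΓ, hΓ0, ?_, fun t => ⟨(hΓ2 t).1, ?_⟩⟩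
      · rw [hΓ1, iteratedWreathToPermHom_succ, leaf_succ, Fin.snoc_last, Fin.init_snoc]
        simp only [W, inv_mul_cancel_left]
      · rw [comp_succ, (hΓ2 t).2, hm]
    · refine Fin.lastCases ?_ (fun j => ?_) j
      · refine ⟨s, hs, ⟨(T.g (n + 1))⁻¹, inv_ne_zero (T.g_ne_zero _), fun t => ?_⟩, ?_⟩
        · rw [hsq, values_last]
        · rw [Fin.snoc_last, levelProd_succ_last, hs0, hq]
          ring
      · choose r hr hκ hr1 using fun x => hw2 x j
        choose κ hκ0 hκ using hκ
        obtain ⟨μ, hμ, hμ2⟩ := T.exists_prod_mob_eq (j := n + 1) (T.norm_values_lt_one n j)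
        -- Multiplying the roots found along all branches gives a root for the image of the critical
        -- value, by `exists_prod_mob_eq`.
        refine ⟨fun t => ∏ x, r x t, continuous_finsetProd _ fun x _ => hr x,
          ⟨(∏ x, κ x) * μ, mul_ne_zero (Finset.prod_ne_zero_iff.2 fun x _ => hκ0 x) hμ,
            fun t => ?_⟩, ?_⟩
        · rw [← Finset.prod_pow, Finset.prod_congr rfl fun x _ => hκ x t, Finset.prod_mul_distrib,
            hμ2 (s t) (p t) (h1 t) (hsq t), values_castSucc, mul_assoc]
        · have e1 : ∏ x, ρ j (T.branch (n + 1) (p 1) (q * x)) =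
              ∏ x, ρ j (T.branch (n + 1) (p 1) x) :=
            Fintype.prod_equiv (Equiv.mulLeft q) _ _ fun _ => rfl
          have e2 : levelProd C2 (n + 1) W j.castSucc = ∏ x, levelProd C2 n (w x) j := by
            rw [levelProd_succ_castSucc]
            exact Fintype.prod_equiv (Equiv.mulLeft q⁻¹) _ _ fun _ => rfl
          rw [Fin.snoc_castSucc, e2, map_prod, ← Finset.prod_mul_distrib,
            Finset.prod_congr rfl fun x _ => hr1 x, Finset.prod_mul_distrib,
            Finset.prod_mul_distrib, e1]

theorem continuous_comp (n : ℕ) {f : I → ℂ} (hf : Continuous f) (h : ∀ t, ‖f t‖ < 1) :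
    Continuous fun t => T.comp n (f t) := by
  induction n with
  | zero => exact hf
  | succ n ih =>
    refine ((continuous_const.mul ((ih.mob (T.norm_c _)
      fun t => T.norm_comp_lt_one n (h t)).pow 2))).mob (by simpa using T.norm_v (n + 1))
      fun t => norm_mul_sq_lt_one (T.norm_g _) (norm_mob_lt_one (T.norm_c _)
        (T.norm_comp_lt_one n (h t)))

/-- Lifts of paths through `T.comp n` are unique away from the critical values. -/
theorem lift_unique {n : ℕ} {Γ Δ : I → ℂ} (hΓ : Continuous Γ) (hΔ : Continuous Δ)
    (hΓ1 : ∀ t, ‖Γ t‖ < 1) (hΔ1 : ∀ t, ‖Δ t‖ < 1) (h : ∀ t, T.comp n (Γ t) = T.comp n (Δ t))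
    (h0 : Γ 0 = Δ 0) (hv : ∀ t j, T.comp n (Γ t) ≠ T.values n j) :
    Γ = Δ := by
  induction n with
  | zero => exact funext h
  | succ n ih =>
    refine ih (fun t => ?_) fun t => T.branch_ne_values (T.comp_succ n _).symm (hv t)
    have hg := fun t => T.norm_comp_lt_one n (hΓ1 t)
    have hd := fun t => T.norm_comp_lt_one n (hΔ1 t)
    have key := eq_of_sq_eq_of_zero_eq (f := fun t => mob (T.c (n + 1)) (T.comp n (Δ t)))
      (g := fun t => mob (T.c (n + 1)) (T.comp n (Γ t)))
      ((T.continuous_comp n hΔ hΔ1).mob (T.norm_c _) hd)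
      ((T.continuous_comp n hΓ hΓ1).mob (T.norm_c _) hg)
      (fun t => ?_) (fun t => ?_) (by simp only [h0])
    · have h1 := congrArg (mob (-T.c (n + 1))) (congrFun key t)
      simp only [mob_neg_mob (T.norm_c _) (hg t), mob_neg_mob (T.norm_c _) (hd t)] at h1
      exact h1.symm
    · exact (T.sq_mob_eq_of_map_eq (hd t) (h t).symm).trans (T.sq_mob_eq_of_map_eq (hg t) rfl).symm
    · intro h3
      rw [mob_eq_zero_iff (T.norm_c _) (hg t)] at h3
      refine hv t (Fin.last n) ?_
      rw [comp_succ, h3, values_last, map, fold_self]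

end FoldTower

/-! ### Normal form of Blaschke products of degree two -/

theorem mob_mob_self {a c z : ℂ} (hc : ‖c‖ < 1) (hz : ‖z‖ < 1)
    (ha : a * (1 + conj c * c) = 2 * c) :
    mob c (mob c z) = mob a z := by
  have h1 := one_sub_conj_mul_ne_zero hc hz
  have hN : 1 + conj c * c ≠ 0 := by
    rw [← Complex.normSq_eq_conj_mul_self]
    exact_mod_cast (by linarith [Complex.normSq_nonneg c] : (1 + Complex.normSq c) ≠ 0)
  have ha' : conj a * (1 + conj c * c) = 2 * conj c := by
    have h := congrArg conj ha
    rw [map_mul, map_add, map_mul, map_one, Complex.conj_conj, map_mul, map_ofNat] at h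
    rwa [mul_comm (conj c)]
  have e1 : mob c z - c = ((1 + conj c * c) * (z - a)) / (1 - conj c * z) := by
    rw [mob, div_sub' h1]
    congr 1
    linear_combination ha
  have e2 : 1 - conj c * mob c z = ((1 + conj c * c) * (1 - conj a * z)) / (1 - conj c * z) := by
    rw [mob, ← mul_div_assoc, one_sub_div h1]
    congr 1
    linear_combination z * ha'
  rw [show mob c (mob c z) = (mob c z - c) / (1 - conj c * mob c z) from rfl, e1, e2,
    div_div_div_cancel_right₀ h1, mul_div_mul_left _ _ hN, mob]

/-- The hyperbolic midpoint of `0` and `a`. -/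
theorem exists_hyperbolic_midpoint {a : ℂ} (ha : ‖a‖ < 1) :
    ∃ c, ‖c‖ < 1 ∧ a * (1 + conj c * c) = 2 * c := by
  have h1 : 0 < 1 - ‖a‖ ^ 2 := by nlinarith [norm_nonneg a]
  -- With `c = t * a` the equation is quadratic in `t`; the root giving a point of the disk is `1 /
  -- (1 + r)`.
  set r := √(1 - ‖a‖ ^ 2) with hr
  have hr0 : 0 < r := Real.sqrt_pos.2 h1
  have hr2 : r ^ 2 = 1 - ‖a‖ ^ 2 := Real.sq_sqrt h1.le
  have hr1 : (1 + r : ℂ) ≠ 0 := by exact_mod_cast (by positivity : (1 + r) ≠ 0)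
  have haa : conj a * a = 1 - (r : ℂ) ^ 2 := by
    rw [← Complex.normSq_eq_conj_mul_self, Complex.normSq_eq_norm_sq]
    have : ‖a‖ ^ 2 = 1 - r ^ 2 := by linarith
    rw [this]
    push_cast
    ring
  refine ⟨a / (1 + r), ?_, ?_⟩
  · rw [norm_div, show (1 + r : ℂ) = ((1 + r : ℝ) : ℂ) by push_cast; ring, Complex.norm_real,
      Real.norm_of_nonneg (by positivity), div_lt_one (by positivity)]
    linarith
  · rw [map_div₀, map_add, map_one, Complex.conj_ofReal, div_mul_div_comm, haa]
    field_simp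
    ring

/-- In the coordinate `mob c z` the zeros `0` and `a` become `-c` and `c`, so the product is a
function of the square of the coordinate by `mob_mul_mob_neg`. -/
theorem mul_mul_mob_eq_fold {a c g z : ℂ} (hc : ‖c‖ < 1) (hg : ‖g‖ = 1) (hz : ‖z‖ < 1)
    (ha : a * (1 + conj c * c) = 2 * c) :
    g * (z * mob a z) = fold c (-(g * c ^ 2)) g z := by
  have h := mob_mul_mob_neg hc (norm_mob_lt_one hc hz)
  have h2 : mob c (-mob c z) = -z := by
    conv_rhs => rw [← mob_neg_mob hc hz]
    simp only [mob, map_neg]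
    rw [← neg_div]
    ring
  rw [fold, neg_neg, mob_mul_left hg, ← neg_eq_iff_eq_neg.2 h, h2, mob_mob_self hc hz ha]
  ring

/-- A Blaschke product of degree two that fixes `0` is a `fold`. -/
theorem FiniteBlaschke.IsBlaschke.exists_eqOn_fold {C : ℂ → ℂ} (h : FiniteBlaschke.IsBlaschke 2 C)
    (h0 : C 0 = 0) :
    ∃ c v g, ‖c‖ < 1 ∧ ‖v‖ < 1 ∧ ‖g‖ = 1 ∧ EqOn C (fold c v g) (ball 0 1) := by
  obtain ⟨g, a, hg, ha, hC⟩ := h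
  have hg0 : g ≠ 0 := norm_ne_zero_iff.1 (by rw [hg]; exact one_ne_zero)
  obtain ⟨b, hb, hCb⟩ : ∃ b, ‖b‖ < 1 ∧ ∀ z, ‖z‖ < 1 → C z = g * (z * mob b z) := by
    have h1 := hC 0 (mem_ball_self one_pos)
    rw [h0, Fin.prod_univ_two] at h1
    have h2 : a 0 = 0 ∨ a 1 = 0 := by simpa [hg0] using h1.symm
    rcases h2 with h1 | h1
    · exact ⟨a 1, ha 1, fun z hz => by
        rw [hC z (by simpa using hz), Fin.prod_univ_two, h1]; simp [mob]⟩
    · exact ⟨a 0, ha 0, fun z hz => by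
        rw [hC z (by simpa using hz), Fin.prod_univ_two, h1]; simp [mob, mul_comm]⟩
  obtain ⟨c, hc, hbc⟩ := exists_hyperbolic_midpoint hb
  refine ⟨c, -(g * c ^ 2), g, hc, by simpa using norm_mul_sq_lt_one hg hc, hg, fun z hz => ?_⟩
  have hz' : ‖z‖ < 1 := by simpa using hz
  rw [hCb z hz', mul_mul_mob_eq_fold hc hg hz' hbc]

/-! ### The composite as a tower, and its critical values -/

namespace FoldTower

theorem exists_composite_eqOn (n : ℕ) (C : ℕ → ℂ → ℂ)
    (hC : ∀ j ∈ Finset.Icc 1 n, FiniteBlaschke.IsBlaschke 2 (C j) ∧ C j 0 = 0) :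
    ∃ T : FoldTower, EqOn (FiniteBlaschke.composite C n) (T.comp n) (ball 0 1) := by
  have h : ∀ j, ∃ c v g, ‖c‖ < 1 ∧ ‖v‖ < 1 ∧ ‖g‖ = 1 ∧
      (j ∈ Finset.Icc 1 n → EqOn (C j) (fold c v g) (ball 0 1)) := by
    intro j
    by_cases hj : j ∈ Finset.Icc 1 n
    · obtain ⟨c, v, g, hc, hv, hg, h⟩ := (hC j hj).1.exists_eqOn_fold (hC j hj).2
      exact ⟨c, v, g, hc, hv, hg, fun _ => h⟩
    -- Outside `1, …, n` any fold will do.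
    · exact ⟨0, 0, 1, by simp, by simp, by simp, fun h => absurd h hj⟩
  choose c v g hc hv hg h using h
  refine ⟨⟨c, v, g, hc, hv, hg⟩, ?_⟩
  set T : FoldTower := ⟨c, v, g, hc, hv, hg⟩
  suffices ∀ k ≤ n, EqOn (FiniteBlaschke.composite C k) (T.comp k) (ball 0 1) from this n le_rfl
  intro k hk
  induction k with
  | zero => exact fun _ _ => rfl
  | succ k ih =>
    intro z hz
    have hz' : T.comp k z ∈ ball (0 : ℂ) 1 := by
      simpa using T.norm_comp_lt_one k (by simpa using hz)
    have h1 : FiniteBlaschke.composite C (k + 1) z = C (k + 1) (FiniteBlaschke.composite C k z) :=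
      rfl
    rw [h1, ih (by omega) hz, h (k + 1) (Finset.mem_Icc.2 ⟨by omega, hk⟩) hz', comp_succ, map]

variable (T : FoldTower)

theorem exists_hasDerivAt_comp (n : ℕ) {z : ℂ} (hz : ‖z‖ < 1) :
    ∃ D, HasDerivAt (T.comp n) D z ∧ (D = 0 → ∃ j, T.comp n z = T.values n j) := by
  induction n with
  | zero => exact ⟨1, hasDerivAt_id z, fun h => absurd h one_ne_zero⟩
  | succ n ih =>
    obtain ⟨D, hD, h⟩ := ih
    have hn := T.norm_comp_lt_one n hz
    obtain ⟨k, hk, h2⟩ := hasDerivAt_fold (T.norm_c (n + 1)) (T.norm_v (n + 1))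
      (T.norm_g (n + 1)) hn
    refine ⟨_, HasDerivAt.comp (h₂ := T.map (n + 1)) z h2 hD, fun h0 => ?_⟩
    rw [mul_eq_zero, mul_eq_zero, or_iff_right hk, mob_eq_zero_iff (T.norm_c _) hn] at h0
    rcases h0 with h0 | h0
    · exact ⟨Fin.last n, by rw [comp_succ, h0, values_last, map, fold_self]⟩
    · obtain ⟨j, hj⟩ := h h0
      exact ⟨j.castSucc, by rw [comp_succ, hj, values_castSucc]⟩

theorem exists_hasDerivAt_comp_zero (n : ℕ) (j : Fin n) :
    ∃ z, ‖z‖ < 1 ∧ HasDerivAt (T.comp n) 0 z ∧ T.comp n z = T.values n j := by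
  induction n with
  | zero => exact j.elim0
  | succ n ih =>
    refine Fin.lastCases ?_ (fun j => ?_) j
    -- Any point over the critical point of the last map serves; the label `1` is arbitrary.
    · have hz := T.norm_leaf_lt_one n (T.norm_c (n + 1)) 1
      have hc := T.comp_leaf n (T.norm_c (n + 1)) 1
      obtain ⟨D, hD, -⟩ := T.exists_hasDerivAt_comp n hz
      obtain ⟨k, hk, h2⟩ := hasDerivAt_fold (T.norm_c (n + 1)) (T.norm_v (n + 1))
        (T.norm_g (n + 1)) (T.norm_comp_lt_one n hz)
      refine ⟨_, hz, (HasDerivAt.comp (h₂ := T.map (n + 1)) _ h2 hD).congr_deriv ?_, ?_⟩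
      · rw [hc, mob_self, mul_zero, zero_mul]
      · rw [comp_succ, hc, values_last, map, fold_self]
    · obtain ⟨z, hz, hD, hj⟩ := ih j
      obtain ⟨k, hk, h2⟩ := hasDerivAt_fold (T.norm_c (n + 1)) (T.norm_v (n + 1))
        (T.norm_g (n + 1)) (T.norm_comp_lt_one n hz)
      exact ⟨z, hz, (HasDerivAt.comp (h₂ := T.map (n + 1)) _ h2 hD).congr_deriv (mul_zero _), by
        rw [comp_succ, hj, values_castSucc]⟩

theorem criticalValues_eq_range {n : ℕ} {B : ℂ → ℂ} (hB : EqOn B (T.comp n) (ball 0 1)) :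
    FiniteBlaschke.criticalValues B = range (T.values n) := by
  have hd : ∀ z ∈ ball (0 : ℂ) 1, deriv B z = deriv (T.comp n) z := fun z hz =>
    (hB.eventuallyEq_of_mem (isOpen_ball.mem_nhds hz)).deriv_eq
  ext y
  constructor
  · rintro ⟨z, ⟨hz, h0⟩, rfl⟩
    obtain ⟨D, hD, h⟩ := T.exists_hasDerivAt_comp n (z := z) (by simpa using hz)
    rw [hd z hz, hD.deriv] at h0
    obtain ⟨j, hj⟩ := h h0
    exact ⟨j, by rw [hB hz, hj]⟩
  · rintro ⟨j, rfl⟩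
    obtain ⟨z, hz, hD, hj⟩ := T.exists_hasDerivAt_comp_zero n j
    have hz' : z ∈ ball (0 : ℂ) 1 := by simpa using hz
    exact ⟨z, ⟨hz', by rw [hd z hz', hD.deriv]⟩, by rw [hB hz', hj]⟩

end FoldTower

/-! ### Loops around a single critical value -/

/-- Write `mob a y = -a * (1 - y / a) / (1 - conj a * y)`. The denominator stays in the slit plane,
so its principal root returns to its initial value and only `h` contributes a sign. -/
theorem exists_sqrt_mob {a : ℂ} (ha : ‖a‖ < 1) (ha0 : a ≠ 0) {p h : I → ℂ} (hp : Continuous p)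
    (hp1 : ∀ t, ‖p t‖ < 1) (h01 : p 0 = p 1) (hh : Continuous h)
    (hsq : ∀ t, h t ^ 2 = 1 - p t / a) {ε : ℂ} (hε : h 1 = ε * h 0) :
    ∃ r : I → ℂ, Continuous r ∧ (∀ t, r t ^ 2 = mob a (p t)) ∧ r 1 = ε * r 0 := by
  have h1 := fun t => one_sub_conj_mul_mem_slitPlane ha (hp1 t)
  refine ⟨fun t => (-a) ^ (((2 : ℕ) : ℂ)⁻¹) * h t *
      ((1 - conj a * p t) ^ (((2 : ℕ) : ℂ)⁻¹))⁻¹, ?_, fun t => ?_, ?_⟩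
  · refine (continuous_const.mul hh).mul (Continuous.inv₀ ?_ fun t => ?_)
    · exact Continuous.cpow (by fun_prop) continuous_const h1
    · exact fun h0 => Complex.slitPlane_ne_zero (h1 t) (by
        rw [← Complex.cpow_nat_inv_pow (1 - conj a * p t) two_ne_zero, h0]; simp)
  · rw [mul_pow, mul_pow, inv_pow, Complex.cpow_nat_inv_pow _ two_ne_zero,
      Complex.cpow_nat_inv_pow _ two_ne_zero, hsq, mob, div_eq_mul_inv]
    congr 1
    field_simp
    ring
  · simp only [h01, hε]
    ring

/-- Paths from `1` to `-1` along half ellipses that degenerate to a segment. -/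
theorem exists_half_ellipses :
    ∃ s : ℝ → I → ℂ, Continuous (fun x : ℝ × I => s x.1 x.2) ∧ (∀ ε, s ε 0 = 1) ∧
      (∀ ε, s ε 1 = -1) ∧ (∀ ε ≠ 0, ∀ t, s ε t ≠ 0) ∧
      ∀ t, ∃ x : ℝ, 0 ≤ x ∧ x ≤ 1 ∧ 1 - s 0 t ^ 2 = (x : ℂ) := by
  refine ⟨fun ε t => ((Real.cos (Real.pi * t) : ℝ) : ℂ) +
    Complex.I * ((ε * Real.sin (Real.pi * t) : ℝ) : ℂ), by fun_prop, fun ε => by simp,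
    fun ε => by simp, fun ε hε t h0 => ?_, fun t => ⟨Real.sin (Real.pi * t) ^ 2, sq_nonneg _,
      Real.sin_sq_le_one _, ?_⟩⟩
  · have hre := congrArg Complex.re h0
    have him := congrArg Complex.im h0
    simp only [Complex.add_re, Complex.add_im, Complex.ofReal_re, Complex.ofReal_im,
      Complex.mul_re, Complex.mul_im, Complex.I_re, Complex.I_im, zero_mul,
      one_mul, mul_zero, sub_zero, add_zero, Complex.zero_re, Complex.zero_im] at hre him
    simp only [zero_add] at him
    have h2 := Real.sin_sq_add_cos_sq (Real.pi * t)
    rw [(mul_eq_zero.1 him).resolve_left hε, show Real.cos (Real.pi * t) = 0 by linarith] at h2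
    norm_num at h2
  · rw [Real.sin_sq]
    push_cast
    ring

/-- A path from `1` to `-1` whose square describes a loop close to the segment from `0` to `a k`,
which avoids the outward rays that start at the other points. -/
theorem exists_half_ellipse_near_segment {n : ℕ} (a : Fin n → ℂ) (ha : ∀ j, ‖a j‖ < 1)
    (hray : ∀ i j, (∃ t : ℝ, 0 < t ∧ a i / a j = (t : ℂ)) → i = j) (k : Fin n) :
    ∃ s : I → ℂ, Continuous s ∧ s 0 = 1 ∧ s 1 = -1 ∧ (∀ t, s t ≠ 0) ∧
      (∀ t, ‖a k * (1 - s t ^ 2)‖ < 1) ∧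
      ∀ t j, j ≠ k → 1 - a k * (1 - s t ^ 2) / a j ∈ Complex.slitPlane := by
  obtain ⟨s, hs, hs0, hs1, hsne, hsx⟩ := exists_half_ellipses
  set P : ℝ → I → ℂ := fun ε t => a k * (1 - s ε t ^ 2) with hPdef
  have hP : Continuous fun x : ℝ × I => P x.1 x.2 := by fun_prop
  let U : Set ℂ := {y | ‖y‖ < 1 ∧ ∀ j, j ≠ k → 1 - y / a j ∈ Complex.slitPlane}
  -- The degenerate ellipse traces the segment from `0` to `a k`, which lies in `U` because the
  -- points lie on different rays. As `U` is open and the interval compact, so do the loops for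
  -- small `ε ≠ 0`, and these avoid `a k`.
  have hU : IsOpen U := by
    have : U = {y | ‖y‖ < 1} ∩ ⋂ j : Fin n, ⋂ _ : j ≠ k, {y | 1 - y / a j ∈ Complex.slitPlane} := by
      ext y; simp [U]
    rw [this]
    refine (isOpen_lt continuous_norm continuous_const).inter (isOpen_iInter_of_finite fun j =>
      isOpen_iInter_of_finite fun _ => Complex.isOpen_slitPlane.preimage (by fun_prop))
  have hP0 : ∀ t, P 0 t ∈ U := by
    intro t
    obtain ⟨x, h0, h1, hx⟩ := hsx t
    simp only [hPdef, hx]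
    refine ⟨?_, fun j hj => ?_⟩
    · rw [norm_mul, Complex.norm_real, Real.norm_of_nonneg h0]
      exact mul_lt_one_of_nonneg_of_lt_one_left (norm_nonneg _) (ha k) h1
    · by_contra hns
      rw [Complex.mem_slitPlane_iff, not_or, not_lt, not_not, Complex.sub_re, Complex.sub_im,
        Complex.one_re, Complex.one_im, mul_div_right_comm, Complex.re_mul_ofReal,
        Complex.im_mul_ofReal] at hns
      obtain ⟨h2, h3⟩ := hns
      have hx : 0 < x := by
        rcases h0.eq_or_lt with h | h
        · rw [← h] at h2; norm_num at h2
        · exact h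
      have h4 : 0 < (a k / a j).re := by
        by_contra h; nlinarith
      have h5 : (a k / a j).im = 0 := by
        rw [zero_sub, neg_eq_zero] at h3
        exact (mul_eq_zero.1 h3).resolve_right hx.ne'
      exact hj (hray k j ⟨_, h4, Complex.ext (by simp) (by simp [h5])⟩).symm
  have hev : ∀ᶠ ε in 𝓝 (0 : ℝ), ∀ t ∈ (univ : Set I), P ε t ∈ U :=
    isCompact_univ.eventually_forall_of_forall_eventually fun t _ =>
      hP.continuousAt.eventually (hU.mem_nhds (hP0 t))
  obtain ⟨ε, hε0, hεU⟩ : ∃ ε : ℝ, ε ≠ 0 ∧ ∀ t, P ε t ∈ U := by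
    have h1 : ∀ᶠ ε in 𝓝[≠] (0 : ℝ), ∀ t ∈ (univ : Set I), P ε t ∈ U :=
      hev.filter_mono nhdsWithin_le_nhds
    have h2 : ∀ᶠ ε in 𝓝[≠] (0 : ℝ), ε ≠ 0 := self_mem_nhdsWithin
    obtain ⟨ε, h3, h4⟩ := (h1.and h2).exists
    exact ⟨ε, h4, fun t => h3 t (mem_univ t)⟩
  have hsc : Continuous fun t => s ε t := hs.comp (Continuous.prodMk_right ε)
  exact ⟨fun t => s ε t, hsc, hs0 ε, hs1 ε, hsne ε hε0, fun t => (hεU t).1,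
    fun t j hj => (hεU t).2 j hj⟩

/-- Among finitely many points in the disk that lie on different rays from `0`, there is a loop
that winds once around a given one and not around the others. -/
theorem exists_loop {n : ℕ} (a : Fin n → ℂ) (ha : ∀ j, ‖a j‖ < 1) (ha0 : ∀ j, a j ≠ 0)
    (hray : ∀ i j, (∃ t : ℝ, 0 < t ∧ a i / a j = (t : ℂ)) → i = j) (k : Fin n) :
    ∃ p : I → ℂ, Continuous p ∧ p 0 = 0 ∧ p 1 = 0 ∧ (∀ t, ‖p t‖ < 1) ∧ (∀ t j, p t ≠ a j) ∧
      ∀ j, ∃ r : I → ℂ, Continuous r ∧ (∀ t, r t ^ 2 = mob (a j) (p t)) ∧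
        r 1 = (if j = k then -1 else 1) * r 0 := by
  obtain ⟨s, hs, hs0, hs1, hsne, hs2, hs3⟩ := exists_half_ellipse_near_segment a ha hray k
  have hP : Continuous fun t => a k * (1 - s t ^ 2) := by fun_prop
  have hP0 : a k * (1 - s 0 ^ 2) = 0 := by rw [hs0]; ring
  have hP1 : a k * (1 - s 1 ^ 2) = 0 := by rw [hs1]; ring
  have hk : ∀ t, s t ^ 2 = 1 - a k * (1 - s t ^ 2) / a k := fun t => by
    rw [mul_div_cancel_left₀ _ (ha0 k)]
    ring
  refine ⟨fun t => a k * (1 - s t ^ 2), hP, hP0, hP1, hs2, fun t j hj => ?_, fun j => ?_⟩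
  · replace hj : a k * (1 - s t ^ 2) = a j := hj
    by_cases hjk : j = k
    · have h := hk t
      rw [hj, hjk, div_self (ha0 k), sub_self] at h
      exact hsne t (pow_eq_zero_iff two_ne_zero |>.1 h)
    · have h := hs3 t j hjk
      rw [hj, div_self (ha0 j), sub_self] at h
      exact Complex.slitPlane_ne_zero h rfl
  · by_cases hjk : j = k
    · rw [if_pos hjk, hjk]
      exact exists_sqrt_mob (ha k) (ha0 k) hP hs2 (hP0.trans hP1.symm) hs hk
        (by rw [hs0, hs1]; ring)
    · rw [if_neg hjk]
      refine exists_sqrt_mob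
        (h := fun t => (1 - a k * (1 - s t ^ 2) / a j) ^ (((2 : ℕ) : ℂ)⁻¹)) (ha j) (ha0 j)
        hP hs2 (hP0.trans hP1.symm) ?_ (fun t => Complex.cpow_nat_inv_pow _ two_ne_zero) ?_
      · exact Continuous.cpow (by fun_prop) continuous_const fun t => hs3 t j hjk
      · simp only [hP0, hP1, one_mul]

/-! ### The monodromy group -/

namespace FoldTower

variable (T : FoldTower)

/-- A loop at `0` acts on the labels of the fibre through an element of the iterated wreath product
whose levels are the continuations of square roots along the loop. -/
theorem exists_wreath_of_loop {n : ℕ} (h0 : ∀ j, 0 ≠ T.values n j) {p : I → ℂ} (hp : Continuous p)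
    (hp0 : p 0 = 0) (hp1 : p 1 = 0) (hp2 : ∀ t, ‖p t‖ < 1) (hp3 : ∀ t j, p t ≠ T.values n j) :
    ∃ w : IteratedWreathProduct C2 n,
      (∀ u, ∃ Γ : I → ℂ, Continuous Γ ∧ Γ 0 = T.leaf n 0 u ∧
        Γ 1 = T.leaf n 0 (iteratedWreathToPermHom C2 n w u) ∧
        ∀ t, ‖Γ t‖ < 1 ∧ T.comp n (Γ t) = p t) ∧
      ∀ j (r : I → ℂ), Continuous r → (∀ t, r t ^ 2 = mob (T.values n j) (p t)) →
        r 1 = sgn (levelProd C2 n w j) * r 0 := by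
  obtain ⟨ρ, hρ, h⟩ := T.exists_transport n
  obtain ⟨w, hw, hw2⟩ := h p hp hp2 hp3
  rw [hp0, hp1] at hw
  refine ⟨w, hw, fun j r hr hrsq => ?_⟩
  obtain ⟨r', hr', ⟨κ, hκ, hsq⟩, h1⟩ := hw2 j
  rw [hp0, hp1] at h1
  have h1 := mul_right_cancel₀ (hρ 0 (by simp) h0 j) h1
  have hm : ∀ t, mob (T.values n j) (p t) ≠ 0 := fun t =>
    (mob_eq_zero_iff (T.norm_values_lt_one n j) (hp2 t)).not.2 (hp3 t j)
  obtain ⟨k, hk⟩ : ∃ k : ℂ, k ^ 2 = κ := ⟨_, Complex.cpow_nat_inv_pow κ two_ne_zero⟩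
  have hk0 : k ≠ 0 := by
    rintro rfl
    exact hκ (by simp [← hk])
  have hrk : ∀ t, r' t ^ 2 = (k * r t) ^ 2 := fun t => by rw [hsq, mul_pow, hk, hrsq]
  obtain ⟨x, hx⟩ := exists_eq_sgn_mul (hrk 0)
  have hx0 : sgn x ≠ 0 := fun h => by simpa [h] using sgn_sq x
  have hr0 : ∀ t, r t ≠ 0 := fun t h => hm t (by rw [← hrsq, h]; simp)
  -- `r'` and `k * r` are continuous roots of the same nonvanishing function, so they differ by a
  -- constant sign and change equally along the loop.
  have key := eq_of_sq_eq_of_zero_eq (g := fun t => sgn x * (k * r t)) hr' (by fun_prop)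
    (fun t => by rw [hrk, mul_pow (sgn x), sgn_sq, one_mul])
    (fun t => mul_ne_zero hx0 (mul_ne_zero hk0 (hr0 t))) hx
  rw [key] at h1
  refine mul_left_cancel₀ (mul_ne_zero hx0 hk0) ?_
  linear_combination h1

/-- The labelling of the zeros of `B`. -/
noncomputable def zerosEquiv {n : ℕ} {B : ℂ → ℂ} (hB : EqOn B (T.comp n) (ball 0 1))
    (h0 : ∀ j, 0 ≠ T.values n j) : (Fin n → C2) ≃ FiniteBlaschke.zeros B :=
  Equiv.ofBijective
    (fun u => ⟨T.leaf n 0 u, by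
      have h := T.norm_leaf_lt_one n (y := 0) (by simp) u
      have h' : T.leaf n 0 u ∈ ball (0 : ℂ) 1 := by simpa using h
      exact ⟨h', by rw [hB h', T.comp_leaf n (by simp)]⟩⟩)
    ⟨fun _ _ h => T.leaf_injective (by simp) h0 (congrArg Subtype.val h), fun z => by
      have hz : ‖(z : ℂ)‖ < 1 := by simpa using z.2.1
      obtain ⟨u, hu⟩ := T.exists_eq_leaf hz ((hB z.2.1).symm.trans z.2.2)
      exact ⟨u, Subtype.ext hu.symm⟩⟩

theorem coe_zerosEquiv {n : ℕ} {B : ℂ → ℂ} (hB : EqOn B (T.comp n) (ball 0 1))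
    (h0 : ∀ j, 0 ≠ T.values n j) (u : Fin n → C2) :
    (T.zerosEquiv hB h0 u : ℂ) = T.leaf n 0 u := rfl

section monodromy

variable {T} {n : ℕ} {B : ℂ → ℂ} (hB : EqOn B (T.comp n) (ball 0 1)) (h0 : ∀ j, 0 ≠ T.values n j)

/-- The action of the iterated wreath product on the zeros of `B`. -/
noncomputable def wreathHom : IteratedWreathProduct C2 n →* Equiv.Perm (FiniteBlaschke.zeros B) :=
  (T.zerosEquiv hB h0).permCongrHom.toMonoidHom.comp (iteratedWreathToPermHom C2 n)

theorem wreathHom_apply (w : IteratedWreathProduct C2 n) (z : FiniteBlaschke.zeros B) :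
    (T.zerosEquiv hB h0).symm (wreathHom hB h0 w z) =
      iteratedWreathToPermHom C2 n w ((T.zerosEquiv hB h0).symm z) :=
  (T.zerosEquiv hB h0).symm_apply_apply _

theorem wreathHom_injective : Function.Injective (wreathHom hB h0) :=
  (T.zerosEquiv hB h0).permCongrHom.injective.comp (iteratedWreathToPermHomInj C2 n)

theorem wreathHom_zerosEquiv (w : IteratedWreathProduct C2 n) (u : Fin n → C2) :
    (wreathHom hB h0 w (T.zerosEquiv hB h0 u) : ℂ) =
      T.leaf n 0 (iteratedWreathToPermHom C2 n w u) := by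
  rw [← coe_zerosEquiv T hB h0, ← Equiv.symm_apply_apply (T.zerosEquiv hB h0) u,
    ← wreathHom_apply, Equiv.apply_symm_apply, Equiv.apply_symm_apply]

/-- The lifts that define `τ` coincide with the transported ones by uniqueness, so their endpoints
agree. -/
theorem exists_wreathHom_eq {γ : Path (0 : ℂ) 0}
    (hγ : ∀ t, γ t ∈ ball (0 : ℂ) 1 \ FiniteBlaschke.criticalValues B)
    {τ : Equiv.Perm (FiniteBlaschke.zeros B)} (hτ : FiniteBlaschke.Induces B γ τ) :
    ∃ w, wreathHom hB h0 w = τ := by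
  have hv : ∀ t j, γ t ≠ T.values n j := fun t j h =>
    (hγ t).2 (by rw [T.criticalValues_eq_range hB, h]; exact mem_range_self j)
  obtain ⟨w, hw, -⟩ := T.exists_wreath_of_loop h0 γ.continuous γ.source γ.target
    (fun t => by simpa using (hγ t).1) hv
  refine ⟨w, Equiv.ext fun z => Subtype.ext ?_⟩
  obtain ⟨u, rfl⟩ := (T.zerosEquiv hB h0).surjective z
  obtain ⟨Γ, hΓ, hΓ0, hΓ1, hΓ2⟩ := hw u
  obtain ⟨Δ, hΔ⟩ := hτ (T.zerosEquiv hB h0 u)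
  have hΔn : ∀ t, T.comp n (Δ t) = γ t := fun t => by rw [← hB (hΔ t).1, (hΔ t).2]
  have key := T.lift_unique (n := n) hΓ Δ.continuous (fun t => (hΓ2 t).1)
    (fun t => by simpa using (hΔ t).1) (fun t => by rw [(hΓ2 t).2, hΔn])
    (by rw [hΓ0, Δ.source, coe_zerosEquiv]) (fun t j => by rw [(hΓ2 t).2]; exact hv t j)
  rw [wreathHom_zerosEquiv, ← hΓ1, key, Δ.target]

theorem exists_wreathHom_mem_monodromyGroup (h : (0 : ℂ) ∉ FiniteBlaschke.criticalValues B)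
    (hray : ∀ i j, (∃ t : ℝ, 0 < t ∧ T.values n i / T.values n j = (t : ℂ)) → i = j) (k : Fin n) :
    ∃ w, wreathHom hB h0 w ∈ FiniteBlaschke.monodromyGroup B h ∧
      levelProd C2 n w = Pi.mulSingle k (Multiplicative.ofAdd 1) := by
  obtain ⟨p, hp, hp0, hp1, hp2, hp3, hr⟩ := exists_loop (T.values n) (T.norm_values_lt_one n)
    (fun j => (h0 j).symm) hray k
  obtain ⟨w, hw, hw2⟩ := T.exists_wreath_of_loop h0 hp hp0 hp1 hp2 hp3
  refine ⟨w, ⟨⟨⟨p, hp⟩, hp0, hp1⟩, fun t => ⟨by simpa using hp2 t, ?_⟩, fun z => ?_⟩, ?_⟩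
  · rw [T.criticalValues_eq_range hB]
    rintro ⟨j, hj⟩
    exact hp3 t j hj.symm
  · obtain ⟨u, rfl⟩ := (T.zerosEquiv hB h0).surjective z
    obtain ⟨Γ, hΓ, hΓ0, hΓ1, hΓ2⟩ := hw u
    refine ⟨⟨⟨Γ, hΓ⟩, hΓ0, hΓ1.trans (wreathHom_zerosEquiv hB h0 w u).symm⟩, fun t => ?_⟩
    have h1 : Γ t ∈ ball (0 : ℂ) 1 := by simpa using (hΓ2 t).1
    exact ⟨h1, (hB h1).trans (hΓ2 t).2⟩
  · funext j
    obtain ⟨r, hrc, hrsq, hr1⟩ := hr j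
    have h1 := hw2 j r hrc hrsq
    have hr0 : r 0 ≠ 0 := by
      intro h
      have h2 := hrsq 0
      rw [h, hp0, mob_zero, zero_pow two_ne_zero, zero_eq_neg] at h2
      exact h0 j h2.symm
    rw [h1] at hr1
    have h2 := mul_right_cancel₀ hr0 hr1
    apply sgn_injective
    rw [h2]
    by_cases hjk : j = k
    · rw [if_pos hjk, hjk, Pi.mulSingle_eq_same, sgn_ofAdd_one]
    · rw [if_neg hjk, Pi.mulSingle_eq_of_ne hjk, map_one]

theorem monodromyGroup_eq_range (h : (0 : ℂ) ∉ FiniteBlaschke.criticalValues B)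
    (hray : ∀ i j, (∃ t : ℝ, 0 < t ∧ T.values n i / T.values n j = (t : ℂ)) → i = j) :
    FiniteBlaschke.monodromyGroup B h = (wreathHom hB h0).range := by
  apply le_antisymm
  · rintro τ ⟨γ, hγ, hτ⟩
    exact exists_wreathHom_eq hB h0 hγ hτ
  · have htop : (FiniteBlaschke.monodromyGroup B h).comap (wreathHom hB h0) = ⊤ := by
      refine eq_top_of_map_levelProd_eq_top (by simp) n _ ?_
      have h1 : ∀ k : Fin n, (Pi.mulSingle k (Multiplicative.ofAdd 1) : Fin n → C2) ∈
          ((FiniteBlaschke.monodromyGroup B h).comap (wreathHom hB h0)).map (levelProd C2 n) :=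
        fun k => exists_wreathHom_mem_monodromyGroup hB h0 h hray k
      rw [eq_top_iff]
      intro f _
      rw [← Finset.univ_prod_mulSingle f]
      refine Subgroup.prod_mem _ fun k _ => ?_
      have h2 : ∀ a : C2, a = 1 ∨ a = Multiplicative.ofAdd 1 := by decide
      rcases h2 (f k) with h2 | h2 <;> rw [h2]
      · rw [Pi.mulSingle_one]; exact Subgroup.one_mem _
      · exact h1 k
    rintro _ ⟨w, rfl⟩
    exact (htop ▸ Subgroup.mem_top w : w ∈ Subgroup.comap _ _)

end monodromy

end FoldTower

end

theorem theorem5p7 (n d : ℕ) (B : ℂ → ℂ) (C : ℕ → ℂ → ℂ)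
    (hB : FiniteBlaschke.IsBlaschke d B)
    (hreg : FiniteBlaschke.IsRegularized B)
    (hpts : FiniteBlaschke.HasDistinctCriticalPoints B)
    (hvals : (FiniteBlaschke.criticalValues B).encard = n)
    (hC : ∀ j ∈ Finset.Icc 1 n, FiniteBlaschke.IsBlaschke 2 (C j) ∧
      FiniteBlaschke.IsRegularized (C j) ∧ C j 0 = 0)
    (hcomp : Set.EqOn B (FiniteBlaschke.composite C n) (Metric.ball (0 : ℂ) 1)) :
    ∃ (e : FiniteBlaschke.zeros B ≃ (Fin n → Multiplicative (ZMod 2)))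
      (φ : FiniteBlaschke.monodromyGroup B hreg.zero_notMem ≃*
        IteratedWreathProduct (Multiplicative (ZMod 2)) n),
      ∀ (σ : FiniteBlaschke.monodromyGroup B hreg.zero_notMem) (z : FiniteBlaschke.zeros B),
        e (σ.1 z) = iteratedWreathToPermHom (Multiplicative (ZMod 2)) n (φ σ) (e z) := by
  obtain ⟨T, hT⟩ := FoldTower.exists_composite_eqOn n C fun j hj => ⟨(hC j hj).1, (hC j hj).2.2⟩
  have hBT := hcomp.trans hT
  have hcv := T.criticalValues_eq_range hBT
  have h0 : ∀ j, 0 ≠ T.values n j := fun j h =>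
    hreg.zero_notMem (by rw [hcv, h]; exact mem_range_self j)
  -- The `n` values of the tower fill a set of `n` elements, so none repeats; regularity then
  -- separates their rays.
  have hinj : Function.Injective (T.values n) := by
    rw [← injOn_univ]
    refine finite_univ.injOn_of_encard_image_eq ?_
    rw [image_univ, ← hcv, hvals]
    simp
  have hray : ∀ i j, (∃ t : ℝ, 0 < t ∧ T.values n i / T.values n j = (t : ℂ)) → i = j := by
    intro i j h
    have hmem : ∀ k, T.values n k ∈ FiniteBlaschke.criticalValues B := fun k => by
      rw [hcv]; exact mem_range_self k
    obtain ⟨z₁, hz₁, h₁⟩ := hmem i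
    obtain ⟨z₂, hz₂, h₂⟩ := hmem j
    rw [← h₁, ← h₂] at h
    exact hinj (by rw [← h₁, ← h₂]; exact hreg.eq_of_pos z₁ hz₁ z₂ hz₂ h)
  refine ⟨(T.zerosEquiv hBT h0).symm,
    (MulEquiv.subgroupCongr (FoldTower.monodromyGroup_eq_range hBT h0 hreg.zero_notMem hray)).trans
      (MonoidHom.ofInjective (FoldTower.wreathHom_injective hBT h0)).symm, fun σ z => ?_⟩
  rw [← FoldTower.wreathHom_apply, MulEquiv.trans_apply, ← MonoidHom.ofInjective_apply
    (FoldTower.wreathHom_injective hBT h0), MulEquiv.apply_symm_apply]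
  rfl
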